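/- **Conversational bandits.** Let $d,T\ge 1$. An instance consists of a finite set of arms $\mathcal A$ with feature vectors $x_a\in\mathbb R^d$, $\|x_a\|_2=1$; non-empty sets $\mathcal A_t\subseteq\mathcal A$ of arms available at round $t$; a finite set of key terms $\mathcal K$ with feature vectors $\tilde x_k\in\mathbb R^d$, $\|\tilde x_k\|_2=1$; and an unknown preference vector $\theta\in\mathbb R^d$. In each round $t=1,\dots,T$ a (possibly randomized) policy first selects, depending on the past, at most one key term $k_t\in\mathcal K$; if it selects one, it observes feedback drawn from $\mathcal N(\langle\tilde x_{k_t},\theta\rangle,1)$. Then, depending on the past and on this feedback, it selects an arm $a_t\in\mathcal A_t$ and observes a reward drawn from $\mathcal N(\langle x_{a_t},\theta\rangle,1)$. Given the choices, the noise is independent of everything before it. The policy may depend on everything except $\theta$, including $T$ and all the sets $\mathcal A_t$. The regret is $R(T)=\sum_{t=1}^T\big(\max_{a\in\mathcal A_t}\langle x_a,\theta\rangle-\langle x_{a_t},\theta\rangle\big)$. **Theorem (Regret lower bound).** There is a universal constant $c>0$ such that: 1. For all integers $d,T\ge1$ there are arms and available sets $\mathcal A_t$ as above, with $|\mathcal A_t|\le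 2$ for all $t$ if $d\le T$, such that for every finite set of key terms with unit feature vectors and every policy there is a $\theta\in\mathbb R^d$ with $\|\theta\|_2\le d/\sqrt T$ and $\mathbb E[R(T)]\ge c\sqrt{dT}$. 2. For all integers $1\le m\le d$ and $T=2^m$ there are arms and available sets $\mathcal A_t$ as above, with $|\mathcal A_t|\le T$ for all $t$ if $d\le T$, such that for every finite set of key terms with unit feature vectors and every policy there is a $\theta\in\mathbb R^d$ with $\|\theta\|_2\le d/\sqrt T$ and $\mathbb E[R(T)]\ge c\sqrt{dT\log T}$. In particular $\|\theta\|_2\le1$ whenever $T\ge d^2$. -/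

import Mathlib

open MeasureTheory ProbabilityTheory

noncomputable section

namespace ConversationalBandit

/-- A finite collection of arms with unit feature vectors in `ℝ^d`, together with the non-empty
subset of arms that is available at each round (rounds are numbered `0, 1, 2, …`). -/
structure ArmSystem (d : ℕ) where
  numArms : ℕ
  feature : Fin numArms → EuclideanSpace ℝ (Fin d)
  norm_feature : ∀ a, ‖feature a‖ = 1
  available : ℕ → Finset (Fin numArms)
  available_nonempty : ∀ t, (available t).Nonempty

/-- A finite collection of key terms with unit feature vectors in `ℝ^d`. -/
structure KeyTerms (d : ℕ) where
  numTerms : ℕ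
  feature : Fin numTerms → EuclideanSpace ℝ (Fin d)
  norm_feature : ∀ k, ‖feature k‖ = 1

/-- The choice of at most one key term: `none` means that no conversation is initiated. -/
abbrev KeyChoice (M : ℕ) : Type := Option (Fin M)

instance (M : ℕ) : MeasurableSpace (KeyChoice M) := ⊤

instance (M : ℕ) : DiscreteMeasurableSpace (KeyChoice M) := ⟨fun _ => trivial⟩

/-- What is recorded in one round with `N` arms and `M` key terms:
`(((key term or none, key term feedback), arm), reward)`. -/
abbrev Round (N M : ℕ) : Type := ((KeyChoice M × ℝ) × Fin N) × ℝ

/-- The history of the first `t` rounds. -/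
abbrev History (N M t : ℕ) : Type := Fin t → Round N M

variable {d : ℕ}

/-- A randomized policy. In each round it selects, given the past, at most one key term, and
then, given the past and the feedback on that key term, one of the available arms. -/
structure Policy (𝒜 : ArmSystem d) (𝒦 : KeyTerms d) where
  key : ∀ t : ℕ, Kernel (History 𝒜.numArms 𝒦.numTerms t) (KeyChoice 𝒦.numTerms)
  arm : ∀ t : ℕ,
    Kernel (History 𝒜.numArms 𝒦.numTerms t × (KeyChoice 𝒦.numTerms × ℝ)) (Fin 𝒜.numArms)
  markov_key : ∀ t, IsMarkovKernel (key t)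
  markov_arm : ∀ t, IsMarkovKernel (arm t)
  arm_mem : ∀ t p, ∀ᵐ a ∂(arm t p), a ∈ 𝒜.available t

attribute [instance] Policy.markov_key Policy.markov_arm

/-- Law of the feedback on a key term `k`: Gaussian with mean `⟪x_k, θ⟫` and variance `1`.
If no key term is queried, there is no feedback, which is recorded as the constant `0`. -/
def keyFeedbackLaw (𝒦 : KeyTerms d) (θ : EuclideanSpace ℝ (Fin d)) :
    KeyChoice 𝒦.numTerms → Measure ℝ
  | none => Measure.dirac 0
  | some k => gaussianReal (inner ℝ (𝒦.feature k) θ) 1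

instance (𝒦 : KeyTerms d) (θ : EuclideanSpace ℝ (Fin d)) (k : KeyChoice 𝒦.numTerms) :
    IsProbabilityMeasure (keyFeedbackLaw 𝒦 θ k) := by
  cases k <;> (unfold keyFeedbackLaw; infer_instance)

def keyFeedback (𝒦 : KeyTerms d) (θ : EuclideanSpace ℝ (Fin d)) :
    Kernel (KeyChoice 𝒦.numTerms) ℝ :=
  Kernel.ofFunOfCountable (keyFeedbackLaw 𝒦 θ)

/-- Law of the reward of an arm: Gaussian with mean `⟪x_a, θ⟫` and variance `1`. -/
def reward (𝒜 : ArmSystem d) (θ : EuclideanSpace ℝ (Fin d)) : Kernel (Fin 𝒜.numArms) ℝ :=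
  Kernel.ofFunOfCountable fun a => gaussianReal (inner ℝ (𝒜.feature a) θ) 1

instance (𝒦 : KeyTerms d) (θ : EuclideanSpace ℝ (Fin d)) :
    IsMarkovKernel (keyFeedback 𝒦 θ) :=
  ⟨fun k => inferInstanceAs (IsProbabilityMeasure (keyFeedbackLaw 𝒦 θ k))⟩

instance (𝒜 : ArmSystem d) (θ : EuclideanSpace ℝ (Fin d)) : IsMarkovKernel (reward 𝒜 θ) :=
  ⟨fun a => inferInstanceAs (IsProbabilityMeasure (gaussianReal (inner ℝ (𝒜.feature a) θ) 1))⟩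

variable {𝒜 : ArmSystem d} {𝒦 : KeyTerms d}

/-- Conditional law of round `t` given the history of the previous rounds, when `π` interacts
with the environment with preference vector `θ`. -/
def step (π : Policy 𝒜 𝒦) (θ : EuclideanSpace ℝ (Fin d)) (t : ℕ) :
    Kernel (History 𝒜.numArms 𝒦.numTerms t) (Round 𝒜.numArms 𝒦.numTerms) :=
  ((π.key t ⊗ₖ Kernel.prodMkLeft _ (keyFeedback 𝒦 θ)) ⊗ₖ π.arm t) ⊗ₖ
    Kernel.prodMkLeft _ (Kernel.prodMkLeft _ (reward 𝒜 θ))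

instance (π : Policy 𝒜 𝒦) (θ : EuclideanSpace ℝ (Fin d)) (t : ℕ) :
    IsMarkovKernel (step π θ t) := by
  unfold step; infer_instance

/-- Append one round to a history. -/
def extend {N M t : ℕ} (p : History N M t × Round N M) : History N M (t + 1) :=
  Fin.snoc (α := fun _ => Round N M) p.1 p.2

theorem measurable_extend {N M t : ℕ} :
    Measurable (extend : History N M t × Round N M → History N M (t + 1)) := by
  refine measurable_pi_lambda _ fun i => ?_
  induction i using Fin.lastCases with
  | last => simpa [extend] using measurable_snd
  | cast i => simpa [extend, Function.comp_def] using
      (measurable_pi_apply i).comp (measurable_fst (α := History N M t) (β := Round N M))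

/-- Law of the history of the first `t` rounds. -/
def law (π : Policy 𝒜 𝒦) (θ : EuclideanSpace ℝ (Fin d)) :
    ∀ t : ℕ, Measure (History 𝒜.numArms 𝒦.numTerms t)
  | 0 => Measure.dirac fun i => i.elim0
  | t + 1 => (law π θ t ⊗ₘ step π θ t).map extend

instance (π : Policy 𝒜 𝒦) (θ : EuclideanSpace ℝ (Fin d)) (t : ℕ) :
    IsProbabilityMeasure (law π θ t) := by
  induction t with
  | zero => unfold law; infer_instance
  | succ t ih =>
    unfold law
    exact Measure.isProbabilityMeasure_map measurable_extend.aemeasurable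

/-- Cumulative regret of a history of `T` rounds. -/
def regret (𝒜 : ArmSystem d) (θ : EuclideanSpace ℝ (Fin d)) {M T : ℕ}
    (h : History 𝒜.numArms M T) : ℝ :=
  ∑ t : Fin T,
    ((𝒜.available t).sup' (𝒜.available_nonempty t) (fun a => inner ℝ (𝒜.feature a) θ) -
      inner ℝ (𝒜.feature (h t).1.2) θ)

def expectedRegret (π : Policy 𝒜 𝒦) (θ : EuclideanSpace ℝ (Fin d)) (T : ℕ) : ℝ :=
  ∫ h, regret 𝒜 θ h ∂(law π θ T)

/-- The regret takes finitely many values, so its expectation is a genuine integral. -/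
theorem integrable_regret (π : Policy 𝒜 𝒦) (θ : EuclideanSpace ℝ (Fin d)) (T : ℕ) :
    Integrable (fun h => regret 𝒜 θ h) (law π θ T) := by
  unfold regret
  refine integrable_finsetSum _ fun t _ => (integrable_const _).sub ?_
  have hm : Measurable fun h : History 𝒜.numArms 𝒦.numTerms T =>
      (inner ℝ (𝒜.feature (h t).1.2) θ : ℝ) :=
    (measurable_of_countable fun a : Fin 𝒜.numArms => (inner ℝ (𝒜.feature a) θ : ℝ)).comp
      ((measurable_pi_apply t).fst.snd)
  refine Integrable.of_bound hm.aestronglyMeasurable ‖θ‖ (Filter.Eventually.of_forall fun h => ?_)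
  calc ‖(inner ℝ (𝒜.feature (h t).1.2) θ : ℝ)‖ ≤ ‖𝒜.feature (h t).1.2‖ * ‖θ‖ :=
        norm_inner_le_norm _ _
    _ = ‖θ‖ := by rw [𝒜.norm_feature, one_mul]

end ConversationalBandit

end

open MeasureTheory ProbabilityTheory

noncomputable section

namespace ConversationalBandit

/-! Split coordinates of ℝ^d into n = `d / g` blocks of size g (fewer than g are left over). In
round t the arms are the 2^g normalized sign patterns on block t mod n, and θ has entries ±Δ, so
every wrong sign in the chosen arm costs 2Δ/√g.

To learn the i-th sign, a policy must tell θ from θ with that sign flipped. Querying a unit vector x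
separates the two means by 2Δ|x i|, and these squared separations sum over i to 4Δ²: one query has a
fixed information budget shared by all signs. A key term is just one more unit query, so it at most
doubles the budget, to 8Δ² per round (`sum_roundGap_flipSign_le`). With Δ = √d/(8√T) the total is
d/8, too little to determine most of the d signs.

Quantitatively, the error of any test is at least log 2 - KL (`log_two_add_integral_llr_le`), and KL
is half the expected sum of squared mean gaps (`log_two_sub_le_test`). Averaging over all sign
patterns and pairing each with its flip bounds below the number of wrong signs
(`sum_log_two_sub_le_sum_wrongSign`). Since n ≤ T, no block is visited more than 2T/n times, so
information cannot be concentrated where it matters (`sum_signInfo_block_le`). The regret is then at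
least √(dTg)/20. For d ≤ T, g = 1 gives the first claim and g = m the second; for d > T, g = d
serves both. -/

/-! ### Testing two hypotheses -/

/-- The total error of a test between `P` and `Q` is at least `log 2 - KL(P ‖ Q)`. -/
theorem log_two_add_integral_llr_le {α : Type*} [MeasurableSpace α] {P Q : Measure α}
    [IsProbabilityMeasure P] [IsProbabilityMeasure Q] {ℓ : α → ℝ} (hℓ : Measurable ℓ)
    (hint : Integrable ℓ P) (hQ : Q = P.withDensity fun x => ENNReal.ofReal (Real.exp (ℓ x)))
    {A : Set α} (hA : MeasurableSet A) :
    Real.log 2 + ∫ x, ℓ x ∂P ≤ P.real A + Q.real Aᶜ := by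
  have hm : Measurable fun x => Real.exp (ℓ x) := Real.measurable_exp.comp hℓ
  have hone : ∫⁻ x, ENNReal.ofReal (Real.exp (ℓ x)) ∂P = 1 := by
    rw [← setLIntegral_univ, ← withDensity_apply _ MeasurableSet.univ, ← hQ, measure_univ]
  have hexp : Integrable (fun x => Real.exp (ℓ x)) P := by
    refine ⟨hm.aestronglyMeasurable, ?_⟩
    rw [hasFiniteIntegral_iff_ofReal (Filter.Eventually.of_forall fun x => (Real.exp_pos _).le),
      hone]
    exact ENNReal.one_lt_top
  have hexp1 : ∫ x, Real.exp (ℓ x) ∂P = 1 := by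
    rw [integral_eq_lintegral_of_nonneg_ae
      (Filter.Eventually.of_forall fun x => (Real.exp_pos _).le) hm.aestronglyMeasurable, hone]
    rfl
  have hQA : Q.real Aᶜ = ∫ x, Aᶜ.indicator (fun x => Real.exp (ℓ x)) x ∂P := by
    rw [integral_indicator hA.compl, measureReal_def, hQ, withDensity_apply _ hA.compl,
      integral_eq_lintegral_of_nonneg_ae
        (Filter.Eventually.of_forall fun x => (Real.exp_pos _).le) hm.aestronglyMeasurable]
  have hPA : P.real A = ∫ x, A.indicator (fun _ => (1 : ℝ)) x ∂P := by
    rw [integral_indicator hA]; simp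
  have hl2 : Real.log 2 ≤ 1 := by
    have := Real.log_le_sub_one_of_pos (show (0 : ℝ) < 2 by norm_num); linarith
  have hi1 : Integrable (A.indicator fun _ => (1 : ℝ)) P := (integrable_const _).indicator hA
  have hi2 : Integrable (Aᶜ.indicator fun x => Real.exp (ℓ x)) P := hexp.indicator hA.compl
  calc Real.log 2 + ∫ x, ℓ x ∂P
      = ∫ x, (Real.log 2 + 1 + ℓ x - Real.exp (ℓ x)) ∂P := by
        have h1 : Integrable (fun x => Real.log 2 + 1 + ℓ x) P := (integrable_const _).add hint
        rw [integral_sub h1 hexp, integral_add (integrable_const _) hint, hexp1]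
        simp; ring
    -- The integrand is at most min(1, exp ℓ) pointwise. Adding 1 - exp ℓ, which integrates to zero,
    -- is what makes such a bound possible.
    _ ≤ ∫ x, (A.indicator (fun _ => (1 : ℝ)) x + Aᶜ.indicator (fun x => Real.exp (ℓ x)) x) ∂P := by
        refine integral_mono (((integrable_const _).add hint).sub hexp) (hi1.add hi2) fun x => ?_
        have h1 : ℓ x + 1 ≤ Real.exp (ℓ x) := Real.add_one_le_exp _
        have h2 : ℓ x + Real.log 2 + 1 ≤ 2 * Real.exp (ℓ x) := by
          have := Real.add_one_le_exp (ℓ x + Real.log 2)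
          rw [Real.exp_add, Real.exp_log (by norm_num)] at this
          linarith
        by_cases hx : x ∈ A
        · simp [hx]; linarith
        · simp [hx]; linarith
    _ = P.real A + Q.real Aᶜ := by rw [integral_add hi1 hi2, hPA, hQA]

/-! ### Integrals with respect to composition products -/

theorem integrable_compProd_of_bound {α β : Type*} [MeasurableSpace α] [MeasurableSpace β]
    {μ : Measure α} [IsProbabilityMeasure μ] {κ : Kernel α β} [IsMarkovKernel κ]
    {f : α × β → ℝ} (hf : Measurable f) (hi : ∀ a, Integrable (fun b => f (a, b)) (κ a)) {C : ℝ}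
    (hC : ∀ a, ∫ b, ‖f (a, b)‖ ∂κ a ≤ C) : Integrable f (μ ⊗ₘ κ) := by
  rw [Measure.integrable_compProd_iff hf.aestronglyMeasurable]
  refine ⟨Filter.Eventually.of_forall hi, ?_⟩
  refine Integrable.of_bound (C := C) ?_ (Filter.Eventually.of_forall fun a => ?_)
  · exact (hf.norm.stronglyMeasurable.integral_kernel_prod_right' (κ := κ)).aestronglyMeasurable
  · rw [Real.norm_of_nonneg (integral_nonneg fun b => norm_nonneg _)]
    exact hC a

/-- `f` is integrable with respect to every `κ a`, with integral `0` and bounded `L¹` norm. -/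
def Kernel.IsCentered {α β : Type*} [MeasurableSpace α] [MeasurableSpace β] (κ : Kernel α β)
    (f : β → ℝ) : Prop :=
  (∀ a, Integrable f (κ a)) ∧ (∀ a, ∫ b, f b ∂κ a = 0) ∧ ∃ C, ∀ a, ∫ b, ‖f b‖ ∂κ a ≤ C

theorem Kernel.IsCentered.add {α β : Type*} [MeasurableSpace α] [MeasurableSpace β]
    {κ : Kernel α β} {f g : β → ℝ} (hf : Kernel.IsCentered κ f) (hg : Kernel.IsCentered κ g) :
    Kernel.IsCentered κ fun b => f b + g b := by
  obtain ⟨hf1, hf2, C, hf3⟩ := hf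
  obtain ⟨hg1, hg2, D, hg3⟩ := hg
  refine ⟨fun a => (hf1 a).add (hg1 a), fun a => ?_, C + D, fun a => ?_⟩
  · rw [integral_add (hf1 a) (hg1 a), hf2, hg2, add_zero]
  · calc ∫ b, ‖f b + g b‖ ∂κ a ≤ ∫ b, (‖f b‖ + ‖g b‖) ∂κ a :=
          integral_mono ((hf1 a).add (hg1 a)).norm ((hf1 a).norm.add (hg1 a).norm)
            fun b => norm_add_le _ _
      _ ≤ C + D := by
          rw [integral_add (hf1 a).norm (hg1 a).norm]
          exact add_le_add (hf3 a) (hg3 a)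

theorem Kernel.IsCentered.compProd_fst {α β γ : Type*} [MeasurableSpace α] [MeasurableSpace β]
    [MeasurableSpace γ] {κ : Kernel α β} [IsMarkovKernel κ] {η : Kernel (α × β) γ}
    [IsMarkovKernel η] {f : β → ℝ} (hm : Measurable f) (hf : Kernel.IsCentered κ f) :
    Kernel.IsCentered (κ ⊗ₖ η) fun p => f p.1 := by
  obtain ⟨hf1, hf2, C, hf3⟩ := hf
  have hmap : ∀ a, ((κ ⊗ₖ η) a).map Prod.fst = κ a := fun a => by
    rw [← Kernel.fst_apply, Kernel.fst_compProd]
  refine ⟨fun a => ?_, fun a => ?_, C, fun a => ?_⟩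
  · have := hf1 a
    rw [← hmap a] at this
    exact (integrable_map_measure hm.aestronglyMeasurable measurable_fst.aemeasurable).1 this
  · rw [← hf2 a, ← hmap a, integral_map measurable_fst.aemeasurable hm.aestronglyMeasurable]
  · rw [← integral_map (f := fun b => ‖f b‖) measurable_fst.aemeasurable
      hm.norm.aestronglyMeasurable, hmap a]
    exact hf3 a

theorem Kernel.isCentered_compProd {α β γ : Type*} [MeasurableSpace α] [MeasurableSpace β]
    [MeasurableSpace γ] {κ : Kernel α β} [IsMarkovKernel κ] {η : Kernel (α × β) γ}
    [IsMarkovKernel η] {f : β × γ → ℝ} (hm : Measurable f)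
    (hf1 : ∀ a b, Integrable (fun c => f (b, c)) (η (a, b)))
    (hf2 : ∀ a b, ∫ c, f (b, c) ∂η (a, b) = 0) {C : ℝ}
    (hf3 : ∀ a b, ∫ c, ‖f (b, c)‖ ∂η (a, b) ≤ C) : Kernel.IsCentered (κ ⊗ₖ η) f := by
  have hint : ∀ a, Integrable f ((κ ⊗ₖ η) a) := fun a => by
    rw [Kernel.compProd_apply_eq_compProd_sectR]
    exact integrable_compProd_of_bound hm (fun b => by simpa using hf1 a b)
      (C := C) (fun b => by simpa using hf3 a b)
  refine ⟨hint, fun a => ?_, C, fun a => ?_⟩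
  · rw [ProbabilityTheory.integral_compProd (hint a)]
    simp [hf2]
  · rw [ProbabilityTheory.integral_compProd (hint a).norm]
    calc ∫ b, ∫ c, ‖f (b, c)‖ ∂η (a, b) ∂κ a ≤ ∫ _, C ∂κ a :=
          integral_mono_of_nonneg
            (Filter.Eventually.of_forall fun b => integral_nonneg fun c => norm_nonneg _)
            (integrable_const _) (Filter.Eventually.of_forall fun b => hf3 a b)
      _ = C := by simp

/-! ### Log-likelihood ratios -/

/-- `ℓ` is the log-likelihood ratio of `κ' a` with respect to `κ a`, for every `a`. -/
def Kernel.HasLLR {α β : Type*} [MeasurableSpace α] [MeasurableSpace β] (κ κ' : Kernel α β)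
    (ℓ : β → ℝ) : Prop :=
  ∀ (a : α) (f : β → ENNReal), Measurable f →
    ∫⁻ b, f b ∂κ' a = ∫⁻ b, ENNReal.ofReal (Real.exp (ℓ b)) * f b ∂κ a

theorem Kernel.HasLLR.refl {α β : Type*} [MeasurableSpace α] [MeasurableSpace β]
    (κ : Kernel α β) : Kernel.HasLLR κ κ fun _ => 0 := fun a f _ => by simp

/-- Densities of successive conditional laws multiply. Here `ℓ₁` and `ℓ₂` do not depend on the
conditioning point `a`, as holds for a round whose feedback depends on the past only through the
current choices. -/
theorem Kernel.HasLLR.compProd {α β γ : Type*} [MeasurableSpace α] [MeasurableSpace β]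
    [MeasurableSpace γ] {κ κ' : Kernel α β} [IsMarkovKernel κ] [IsMarkovKernel κ']
    {η η' : Kernel (α × β) γ} [IsMarkovKernel η] [IsMarkovKernel η'] {ℓ₁ : β → ℝ}
    {ℓ₂ : β × γ → ℝ} (h₁ : Measurable ℓ₁) (h₂ : Measurable ℓ₂) (hκ : Kernel.HasLLR κ κ' ℓ₁)
    (hη : ∀ a b (f : γ → ENNReal), Measurable f → ∫⁻ c, f c ∂η' (a, b) =
      ∫⁻ c, ENNReal.ofReal (Real.exp (ℓ₂ (b, c))) * f c ∂η (a, b)) :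
    Kernel.HasLLR (κ ⊗ₖ η) (κ' ⊗ₖ η') fun p => ℓ₁ p.1 + ℓ₂ p := by
  intro a f hf
  have hexp₂ : Measurable fun p => ENNReal.ofReal (Real.exp (ℓ₂ p)) :=
    (Real.measurable_exp.comp h₂).ennreal_ofReal
  have hexp : Measurable fun p : β × γ => ENNReal.ofReal (Real.exp (ℓ₁ p.1 + ℓ₂ p)) :=
    (Real.measurable_exp.comp ((h₁.comp measurable_fst).add h₂)).ennreal_ofReal
  have hf' : ∀ b, Measurable fun c => f (b, c) := fun b => hf.comp measurable_prodMk_left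
  have hη' : ∀ b, ∫⁻ c, f (b, c) ∂η' (a, b) =
      ∫⁻ c, ENNReal.ofReal (Real.exp (ℓ₂ (b, c))) * f (b, c) ∂η (a, b) :=
    fun b => hη a b _ (hf' b)
  have hm : Measurable fun b =>
      ∫⁻ c, ENNReal.ofReal (Real.exp (ℓ₂ (b, c))) * f (b, c) ∂η (a, b) := by
    have := (hexp₂.mul hf).lintegral_kernel_prod_right' (κ := η.sectR a)
    simpa using this
  rw [Kernel.lintegral_compProd _ _ _ hf, Kernel.lintegral_compProd κ η a
    (show Measurable fun p => ENNReal.ofReal (Real.exp (ℓ₁ p.1 + ℓ₂ p)) * f p from hexp.mul hf)]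
  simp_rw [hη']
  rw [hκ a _ hm]
  refine lintegral_congr fun b => ?_
  rw [← lintegral_const_mul _
    (show Measurable fun c => ENNReal.ofReal (Real.exp (ℓ₂ (b, c))) * f (b, c) from
      (hexp₂.comp measurable_prodMk_left).mul (hf' b))]
  refine lintegral_congr fun c => ?_
  rw [Real.exp_add, ENNReal.ofReal_mul (Real.exp_pos _).le, mul_assoc]

/-- The log-likelihood ratio of `𝒩(m', 1)` with respect to `𝒩(m, 1)`. -/
def gaussianLLR (m m' y : ℝ) : ℝ := (m' - m) * (y - m) - (m' - m) ^ 2 / 2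

theorem measurable_gaussianLLR (m m' : ℝ) : Measurable (gaussianLLR m m') := by
  unfold gaussianLLR; fun_prop

theorem lintegral_gaussianReal_eq (m m' : ℝ) {f : ℝ → ENNReal} (hf : Measurable f) :
    ∫⁻ y, f y ∂gaussianReal m' 1 =
      ∫⁻ y, ENNReal.ofReal (Real.exp (gaussianLLR m m' y)) * f y ∂gaussianReal m 1 := by
  have hexp : Measurable fun y => ENNReal.ofReal (Real.exp (gaussianLLR m m' y)) :=
    (Real.measurable_exp.comp (measurable_gaussianLLR m m')).ennreal_ofReal
  rw [gaussianReal_of_var_ne_zero _ one_ne_zero, gaussianReal_of_var_ne_zero _ one_ne_zero,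
    lintegral_withDensity_eq_lintegral_mul _ (measurable_gaussianPDF _ _) hf,
    lintegral_withDensity_eq_lintegral_mul _ (measurable_gaussianPDF m 1)
      (show Measurable fun y => ENNReal.ofReal (Real.exp (gaussianLLR m m' y)) * f y from
        hexp.mul hf)]
  refine lintegral_congr fun y => ?_
  simp only [Pi.mul_apply, gaussianPDF, gaussianPDFReal]
  rw [← mul_assoc, ← ENNReal.ofReal_mul (by positivity), mul_assoc _ (Real.exp _) (Real.exp _),
    ← Real.exp_add]
  congr 4
  simp only [gaussianLLR, NNReal.coe_one]
  ring

theorem integrable_gaussianReal_sub (m c : ℝ) :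
    Integrable (fun y => c * (y - m)) (gaussianReal m 1) :=
  (((memLp_id_gaussianReal (μ := m) (v := 1) 1).integrable le_rfl).sub
    (integrable_const _)).const_mul _

theorem integral_gaussianReal_sub (m c : ℝ) :
    ∫ y, c * (y - m) ∂gaussianReal m 1 = 0 := by
  have h : Integrable (fun y : ℝ => y) (gaussianReal m 1) :=
    (memLp_id_gaussianReal (μ := m) (v := 1) 1).integrable le_rfl
  rw [integral_const_mul, integral_sub h (integrable_const _), integral_id_gaussianReal]
  simp

variable {d : ℕ} {𝒜 : ArmSystem d} {𝒦 : KeyTerms d}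

/-- Log-likelihood ratio of the key term feedback under `θ'` with respect to `θ`. -/
def keyLLR (𝒦 : KeyTerms d) (θ θ' : EuclideanSpace ℝ (Fin d)) : KeyChoice 𝒦.numTerms × ℝ → ℝ
  | (none, _) => 0
  | (some k, y) => gaussianLLR (inner ℝ (𝒦.feature k) θ) (inner ℝ (𝒦.feature k) θ') y

/-- Log-likelihood ratio of the reward under `θ'` with respect to `θ`. -/
def armLLR (𝒜 : ArmSystem d) (θ θ' : EuclideanSpace ℝ (Fin d)) (p : Fin 𝒜.numArms × ℝ) : ℝ :=
  gaussianLLR (inner ℝ (𝒜.feature p.1) θ) (inner ℝ (𝒜.feature p.1) θ') p.2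

/-- Squared difference of the mean feedbacks on a key term. -/
def keyGap (𝒦 : KeyTerms d) (θ θ' : EuclideanSpace ℝ (Fin d)) : KeyChoice 𝒦.numTerms → ℝ
  | none => 0
  | some k => (inner ℝ (𝒦.feature k) (θ' - θ)) ^ 2

/-- Squared difference of the mean rewards of an arm. -/
def armGap (𝒜 : ArmSystem d) (θ θ' : EuclideanSpace ℝ (Fin d)) (a : Fin 𝒜.numArms) : ℝ :=
  (inner ℝ (𝒜.feature a) (θ' - θ)) ^ 2

/-- Log-likelihood ratio of the observations of one round. -/
def roundLLR (𝒜 : ArmSystem d) (𝒦 : KeyTerms d) (θ θ' : EuclideanSpace ℝ (Fin d))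
    (r : Round 𝒜.numArms 𝒦.numTerms) : ℝ :=
  keyLLR 𝒦 θ θ' r.1.1 + armLLR 𝒜 θ θ' (r.1.2, r.2)

/-- Sum of the squared mean differences of the queries made in one round. -/
def roundGap (𝒜 : ArmSystem d) (𝒦 : KeyTerms d) (θ θ' : EuclideanSpace ℝ (Fin d))
    (r : Round 𝒜.numArms 𝒦.numTerms) : ℝ :=
  keyGap 𝒦 θ θ' r.1.1.1 + armGap 𝒜 θ θ' r.1.2

variable (θ θ' : EuclideanSpace ℝ (Fin d))

theorem measurable_keyLLR : Measurable (keyLLR 𝒦 θ θ') := by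
  refine measurable_from_prod_countable_right fun k => ?_
  cases k with
  | none => exact measurable_const
  | some k => exact measurable_gaussianLLR _ _

theorem measurable_armLLR : Measurable (armLLR 𝒜 θ θ') :=
  measurable_from_prod_countable_right fun _ => by
    simpa only [armLLR] using measurable_gaussianLLR _ _

theorem measurable_roundLLR : Measurable (roundLLR 𝒜 𝒦 θ θ') :=
  ((measurable_keyLLR θ θ').comp measurable_fst.fst).add
    ((measurable_armLLR θ θ').comp (measurable_fst.snd.prodMk measurable_snd))

theorem measurable_roundGap : Measurable (roundGap 𝒜 𝒦 θ θ') :=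
  ((measurable_of_countable (keyGap 𝒦 θ θ')).comp measurable_fst.fst.fst).add
    ((measurable_of_countable (armGap 𝒜 θ θ')).comp measurable_fst.snd)

theorem lintegral_keyFeedback (k : KeyChoice 𝒦.numTerms) {f : ℝ → ENNReal} (hf : Measurable f) :
    ∫⁻ y, f y ∂keyFeedback 𝒦 θ' k =
      ∫⁻ y, ENNReal.ofReal (Real.exp (keyLLR 𝒦 θ θ' (k, y))) * f y ∂keyFeedback 𝒦 θ k := by
  cases k with
  | none => simp [keyFeedback, keyFeedbackLaw, Kernel.ofFunOfCountable, keyLLR]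
  | some k => exact lintegral_gaussianReal_eq _ _ hf

theorem lintegral_reward (a : Fin 𝒜.numArms) {f : ℝ → ENNReal} (hf : Measurable f) :
    ∫⁻ y, f y ∂reward 𝒜 θ' a =
      ∫⁻ y, ENNReal.ofReal (Real.exp (armLLR 𝒜 θ θ' (a, y))) * f y ∂reward 𝒜 θ a :=
  lintegral_gaussianReal_eq _ _ hf


/-- The policy's own kernels are the same under both preference vectors and contribute ratio 1; only
the two Gaussian feedbacks remain. -/
theorem hasLLR_step (π : Policy 𝒜 𝒦) (t : ℕ) :
    Kernel.HasLLR (step π θ t) (step π θ' t) (roundLLR 𝒜 𝒦 θ θ') := by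
  have h1 : Kernel.HasLLR (π.key t ⊗ₖ Kernel.prodMkLeft _ (keyFeedback 𝒦 θ))
      (π.key t ⊗ₖ Kernel.prodMkLeft _ (keyFeedback 𝒦 θ')) fun p => 0 + keyLLR 𝒦 θ θ' (p.1, p.2) :=
    Kernel.HasLLR.compProd measurable_const (measurable_keyLLR θ θ') (Kernel.HasLLR.refl _)
      fun _ k _ hf => lintegral_keyFeedback θ θ' k hf
  have h2 := Kernel.HasLLR.compProd (ℓ₂ := fun _ => 0) (η := π.arm t) (η' := π.arm t)
    (measurable_const.add ((measurable_keyLLR θ θ').comp (measurable_fst.prodMk measurable_snd)))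
    measurable_const h1 fun a b f _ => by simp
  have h3 := Kernel.HasLLR.compProd
    (ℓ₂ := fun p : ((KeyChoice 𝒦.numTerms × ℝ) × Fin 𝒜.numArms) × ℝ =>
      armLLR 𝒜 θ θ' (p.1.2, p.2))
    (η := Kernel.prodMkLeft _ (Kernel.prodMkLeft _ (reward 𝒜 θ)))
    (η' := Kernel.prodMkLeft _ (Kernel.prodMkLeft _ (reward 𝒜 θ')))
    (((measurable_const.add ((measurable_keyLLR θ θ').comp
      (measurable_fst.prodMk measurable_snd))).comp measurable_fst).add measurable_const)
    ((measurable_armLLR θ θ').comp (measurable_fst.snd.prodMk measurable_snd)) h2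
    fun a b f hf => lintegral_reward θ θ' b.2 hf
  have hr : roundLLR 𝒜 𝒦 θ θ' = fun p : Round 𝒜.numArms 𝒦.numTerms =>
      0 + keyLLR 𝒦 θ θ' (p.1.1.1, p.1.1.2) + 0 + armLLR 𝒜 θ θ' (p.1.2, p.2) := by
    funext r
    simp [roundLLR]
  rw [hr]
  exact h3

theorem sum_extend {N M t : ℕ} (f : Round N M → ℝ) (p : History N M t × Round N M) :
    ∑ i, f (extend p i) = ∑ i, f (p.1 i) + f p.2 := by
  simp [Fin.sum_univ_castSucc, extend]

theorem lintegral_law (π : Policy 𝒜 𝒦) (t : ℕ) :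
    ∀ {f : History 𝒜.numArms 𝒦.numTerms t → ENNReal}, Measurable f →
    ∫⁻ h, f h ∂law π θ' t =
      ∫⁻ h, ENNReal.ofReal (Real.exp (∑ i, roundLLR 𝒜 𝒦 θ θ' (h i))) * f h ∂law π θ t := by
  induction t with
  | zero => intro f hf; simp [law]
  | succ t ih =>
    intro f hf
    have hr := measurable_roundLLR (𝒜 := 𝒜) (𝒦 := 𝒦) θ θ'
    have hfe : Measurable fun p : History 𝒜.numArms 𝒦.numTerms t × Round _ _ =>
        f (extend p) := hf.comp measurable_extend
    have hsum : ∀ t, Measurable fun h : History 𝒜.numArms 𝒦.numTerms t =>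
        ENNReal.ofReal (Real.exp (∑ i, roundLLR 𝒜 𝒦 θ θ' (h i))) := fun t =>
      (Real.measurable_exp.comp (Finset.measurable_sum _ fun i _ =>
        hr.comp (measurable_pi_apply i))).ennreal_ofReal
    have hexp : Measurable fun r => ENNReal.ofReal (Real.exp (roundLLR 𝒜 𝒦 θ θ' r)) :=
      (Real.measurable_exp.comp hr).ennreal_ofReal
    have hg : Measurable fun h : History 𝒜.numArms 𝒦.numTerms (t + 1) =>
        ENNReal.ofReal (Real.exp (∑ i, roundLLR 𝒜 𝒦 θ θ' (h i))) * f h := (hsum _).mul hf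
    simp only [law]
    rw [lintegral_map hf measurable_extend, lintegral_map hg measurable_extend,
      Measure.lintegral_compProd hfe, Measure.lintegral_compProd
        (f := fun p => ENNReal.ofReal (Real.exp (∑ i, roundLLR 𝒜 𝒦 θ θ' (extend p i))) *
          f (extend p)) (hg.comp measurable_extend)]
    have hfe' : ∀ h, Measurable fun r => f (extend (h, r)) := fun h =>
      hfe.comp measurable_prodMk_left
    have hstep : ∀ h, ∫⁻ r, f (extend (h, r)) ∂step π θ' t h =
        ∫⁻ r, ENNReal.ofReal (Real.exp (roundLLR 𝒜 𝒦 θ θ' r)) * f (extend (h, r))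
          ∂step π θ t h := fun h => hasLLR_step θ θ' π t h _ (hfe' h)
    simp_rw [hstep]
    have hinner : Measurable fun h => ∫⁻ r,
        ENNReal.ofReal (Real.exp (roundLLR 𝒜 𝒦 θ θ' r)) * f (extend (h, r)) ∂step π θ t h :=
      Measurable.lintegral_kernel_prod_right' (κ := step π θ t)
        ((hexp.comp measurable_snd).mul hfe)
    -- The induction hypothesis is needed for the conditional integral over the last round, not for
    -- `f`; hence `f` is quantified inside the induction.
    rw [ih hinner]
    refine lintegral_congr fun h => ?_
    rw [← lintegral_const_mul _ (show Measurable fun r =>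
      ENNReal.ofReal (Real.exp (roundLLR 𝒜 𝒦 θ θ' r)) * f (extend (h, r)) from
        hexp.mul (hfe' h))]
    refine lintegral_congr fun r => ?_
    rw [sum_extend, Real.exp_add, ENNReal.ofReal_mul (Real.exp_pos _).le, mul_assoc]

theorem law_eq_withDensity (π : Policy 𝒜 𝒦) (t : ℕ) :
    law π θ' t = (law π θ t).withDensity fun h =>
      ENNReal.ofReal (Real.exp (∑ i, roundLLR 𝒜 𝒦 θ θ' (h i))) := by
  ext s hs
  rw [withDensity_apply _ hs, ← lintegral_indicator_one hs,
    lintegral_law θ θ' π t (measurable_one.indicator hs), ← lintegral_indicator hs]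
  refine lintegral_congr fun h => ?_
  by_cases hh : h ∈ s <;> simp [hh]

/-! ### The information gathered by a policy -/

/-- The log-likelihood ratio of two unit-variance Gaussians has mean -(m' - m)²/2 under the first.
The uniform L¹ bounds exist because there are finitely many key terms and arms. -/
theorem isCentered_step (π : Policy 𝒜 𝒦) (t : ℕ) :
    Kernel.IsCentered (step π θ t) fun r => roundLLR 𝒜 𝒦 θ θ' r + roundGap 𝒜 𝒦 θ θ' r / 2 := by
  have hk : Measurable fun p : KeyChoice 𝒦.numTerms × ℝ =>
      keyLLR 𝒦 θ θ' p + keyGap 𝒦 θ θ' p.1 / 2 :=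
    (measurable_keyLLR θ θ').add
      (((measurable_of_countable (keyGap 𝒦 θ θ')).comp measurable_fst).div_const 2)
  have ha : Measurable fun r : Round 𝒜.numArms 𝒦.numTerms =>
      armLLR 𝒜 θ θ' (r.1.2, r.2) + armGap 𝒜 θ θ' r.1.2 / 2 :=
    ((measurable_armLLR θ θ').comp (measurable_fst.snd.prodMk measurable_snd)).add
      (((measurable_of_countable (armGap 𝒜 θ θ')).comp measurable_fst.snd).div_const 2)
  have hg : ∀ m m' y : ℝ, gaussianLLR m m' y + (m' - m) ^ 2 / 2 = (m' - m) * (y - m) :=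
    fun m m' y => by unfold gaussianLLR; ring
  have key : ∀ k, Integrable (fun y => keyLLR 𝒦 θ θ' (k, y) + keyGap 𝒦 θ θ' k / 2)
      (keyFeedback 𝒦 θ k) ∧
      ∫ y, (keyLLR 𝒦 θ θ' (k, y) + keyGap 𝒦 θ θ' k / 2) ∂keyFeedback 𝒦 θ k = 0 := by
    rintro (_ | k)
    · simp [keyLLR, keyGap]
    · simp only [keyLLR, keyGap, inner_sub_right, hg]
      exact ⟨integrable_gaussianReal_sub _ _, integral_gaussianReal_sub _ _⟩
  have arm : ∀ a, Integrable (fun y => armLLR 𝒜 θ θ' (a, y) + armGap 𝒜 θ θ' a / 2)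
      (reward 𝒜 θ a) ∧
      ∫ y, (armLLR 𝒜 θ θ' (a, y) + armGap 𝒜 θ θ' a / 2) ∂reward 𝒜 θ a = 0 := by
    intro a
    simp only [armLLR, armGap, inner_sub_right, hg]
    exact ⟨integrable_gaussianReal_sub _ _, integral_gaussianReal_sub _ _⟩
  have h1 : Kernel.IsCentered (π.key t ⊗ₖ Kernel.prodMkLeft _ (keyFeedback 𝒦 θ))
      fun p => keyLLR 𝒦 θ θ' p + keyGap 𝒦 θ θ' p.1 / 2 :=
    Kernel.isCentered_compProd hk (fun _ k => (key k).1) (fun _ k => (key k).2)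
      (C := ∑ k, ∫ y, ‖keyLLR 𝒦 θ θ' (k, y) + keyGap 𝒦 θ θ' k / 2‖ ∂keyFeedback 𝒦 θ k)
      fun _ k => Finset.single_le_sum
        (f := fun k => ∫ y, ‖keyLLR 𝒦 θ θ' (k, y) + keyGap 𝒦 θ θ' k / 2‖ ∂keyFeedback 𝒦 θ k)
        (fun k _ => integral_nonneg fun y => norm_nonneg _) (Finset.mem_univ k)
  have h2 : Kernel.IsCentered (step π θ t)
      fun r => armLLR 𝒜 θ θ' (r.1.2, r.2) + armGap 𝒜 θ θ' r.1.2 / 2 :=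
    Kernel.isCentered_compProd ha (fun _ p => (arm p.2).1) (fun _ p => (arm p.2).2)
      (C := ∑ a, ∫ y, ‖armLLR 𝒜 θ θ' (a, y) + armGap 𝒜 θ θ' a / 2‖ ∂reward 𝒜 θ a)
      fun _ p => Finset.single_le_sum
        (f := fun a => ∫ y, ‖armLLR 𝒜 θ θ' (a, y) + armGap 𝒜 θ θ' a / 2‖ ∂reward 𝒜 θ a)
        (fun a _ => integral_nonneg fun y => norm_nonneg _) (Finset.mem_univ p.2)
  have h3 : Kernel.IsCentered (step π θ t)
      fun r => keyLLR 𝒦 θ θ' r.1.1 + keyGap 𝒦 θ θ' r.1.1.1 / 2 :=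
    (h1.compProd_fst hk (η := π.arm t)).compProd_fst (hk.comp measurable_fst)
  convert h3.add h2 using 2 with r
  simp only [roundLLR, roundGap]
  ring

/-- The summands are martingale increments. Applied to the log-likelihood ratio plus half the gap,
this is the chain rule for KL. -/
theorem integrable_law_sum_and_integral_eq_zero (π : Policy 𝒜 𝒦)
    {f : Round 𝒜.numArms 𝒦.numTerms → ℝ} (hf : Measurable f)
    (hc : ∀ t, Kernel.IsCentered (step π θ t) f) (t : ℕ) :
    Integrable (fun h => ∑ i, f (h i)) (law π θ t) ∧ ∫ h, ∑ i, f (h i) ∂law π θ t = 0 := by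
  have hm : ∀ t, Measurable fun h : History 𝒜.numArms 𝒦.numTerms t => ∑ i, f (h i) := fun t =>
    Finset.measurable_sum _ fun i _ => hf.comp (measurable_pi_apply i)
  induction t with
  | zero => simp
  | succ t ih =>
    obtain ⟨h1, h2, C, h3⟩ := hc t
    have hsnd : Integrable (fun p => f p.2) (law π θ t ⊗ₘ step π θ t) :=
      integrable_compProd_of_bound (hf.comp measurable_snd) h1 h3
    have hfst : Integrable (fun p => ∑ i, f (p.1 i)) (law π θ t ⊗ₘ step π θ t) := by
      have := ih.1
      rw [← Measure.fst_compProd (law π θ t) (step π θ t)] at this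
      exact (integrable_map_measure (hm t).aestronglyMeasurable measurable_fst.aemeasurable).1 this
    have hfst0 : ∫ p, ∑ i, f (p.1 i) ∂(law π θ t ⊗ₘ step π θ t) = 0 := by
      have := ih.2
      rw [← Measure.fst_compProd (law π θ t) (step π θ t), Measure.fst,
        integral_map measurable_fst.aemeasurable (hm t).aestronglyMeasurable] at this
      exact this
    simp only [law]
    rw [integrable_map_measure (hm _).aestronglyMeasurable measurable_extend.aemeasurable,
      integral_map measurable_extend.aemeasurable (hm _).aestronglyMeasurable]
    simp only [Function.comp_def, sum_extend]
    refine ⟨hfst.add hsnd, ?_⟩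
    rw [integral_add hfst hsnd, hfst0, Measure.integral_compProd hsnd]
    simp [h2]

/-- A crude bound that serves integrability only. -/
theorem keyGap_le (k : KeyChoice 𝒦.numTerms) : keyGap 𝒦 θ θ' k ≤ ‖θ' - θ‖ ^ 2 := by
  cases k with
  | none => exact sq_nonneg _
  | some k =>
    have := abs_real_inner_le_norm (𝒦.feature k) (θ' - θ)
    rw [𝒦.norm_feature, one_mul] at this
    exact sq_le_sq' (abs_le.1 this).1 (abs_le.1 this).2

theorem armGap_le (a : Fin 𝒜.numArms) : armGap 𝒜 θ θ' a ≤ ‖θ' - θ‖ ^ 2 := by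
  have := abs_real_inner_le_norm (𝒜.feature a) (θ' - θ)
  rw [𝒜.norm_feature, one_mul] at this
  exact sq_le_sq' (abs_le.1 this).1 (abs_le.1 this).2

theorem roundGap_nonneg (r : Round 𝒜.numArms 𝒦.numTerms) : 0 ≤ roundGap 𝒜 𝒦 θ θ' r := by
  refine add_nonneg ?_ (sq_nonneg _)
  rcases r.1.1.1 with _ | k
  · exact le_rfl
  · exact sq_nonneg _

theorem integrable_roundGap (π : Policy 𝒜 𝒦) (T : ℕ) (t : Fin T) :
    Integrable (fun h => roundGap 𝒜 𝒦 θ θ' (h t)) (law π θ T) := by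
  refine Integrable.of_bound
    ((measurable_roundGap θ θ').comp (measurable_pi_apply t)).aestronglyMeasurable
    (‖θ' - θ‖ ^ 2 + ‖θ' - θ‖ ^ 2) (Filter.Eventually.of_forall fun h => ?_)
  rw [Real.norm_of_nonneg (roundGap_nonneg θ θ' _)]
  exact add_le_add (keyGap_le θ θ' _) (armGap_le θ θ' _)

/-- The information about `θ` versus `θ'` gathered in `T` rounds bounds the quality of any test. -/
theorem log_two_sub_le_test (π : Policy 𝒜 𝒦) (T : ℕ)
    {A : Set (History 𝒜.numArms 𝒦.numTerms T)} (hA : MeasurableSet A) :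
    Real.log 2 - (∫ h, ∑ t, roundGap 𝒜 𝒦 θ θ' (h t) ∂law π θ T) / 2 ≤
      (law π θ T).real A + (law π θ' T).real Aᶜ := by
  obtain ⟨hi, h0⟩ := integrable_law_sum_and_integral_eq_zero θ π
    (f := fun r => roundLLR 𝒜 𝒦 θ θ' r + roundGap 𝒜 𝒦 θ θ' r / 2)
    ((measurable_roundLLR θ θ').add ((measurable_roundGap θ θ').div_const 2))
    (fun t => isCentered_step θ θ' π t) T
  have hgap : Integrable (fun h => ∑ t, roundGap 𝒜 𝒦 θ θ' (h t)) (law π θ T) :=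
    integrable_finsetSum _ fun t _ => integrable_roundGap θ θ' π T t
  have heq : ∀ h : History 𝒜.numArms 𝒦.numTerms T, ∑ t, roundLLR 𝒜 𝒦 θ θ' (h t) =
      ∑ t, (roundLLR 𝒜 𝒦 θ θ' (h t) + roundGap 𝒜 𝒦 θ θ' (h t) / 2) -
        (∑ t, roundGap 𝒜 𝒦 θ θ' (h t)) / 2 := fun h => by
    rw [Finset.sum_add_distrib, Finset.sum_div, add_sub_cancel_right]
  have hllr : Integrable (fun h => ∑ t, roundLLR 𝒜 𝒦 θ θ' (h t)) (law π θ T) := by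
    simp_rw [heq]
    exact hi.sub (hgap.div_const 2)
  have hval : ∫ h, ∑ t, roundLLR 𝒜 𝒦 θ θ' (h t) ∂law π θ T =
      -((∫ h, ∑ t, roundGap 𝒜 𝒦 θ θ' (h t) ∂law π θ T) / 2) := by
    simp_rw [heq]
    rw [integral_sub hi (hgap.div_const 2), h0, zero_sub, integral_div]
  have hm : Measurable fun h : History 𝒜.numArms 𝒦.numTerms T =>
      ∑ t, roundLLR 𝒜 𝒦 θ θ' (h t) := Finset.measurable_sum _ fun t _ =>
    (measurable_roundLLR θ θ').comp (measurable_pi_apply t)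
  have := log_two_add_integral_llr_le hm hllr
    (law_eq_withDensity θ θ' π T) hA
  rw [hval] at this
  linarith

/-- A policy almost surely selects available arms. -/
theorem ae_arm_mem_available (π : Policy 𝒜 𝒦) (T : ℕ) :
    ∀ᵐ h ∂law π θ T, ∀ t : Fin T, (h t).1.2 ∈ 𝒜.available t := by
  have hm : ∀ t : ℕ, MeasurableSet {a : Fin 𝒜.numArms | a ∈ 𝒜.available t} :=
    fun t => (Set.to_countable _).measurableSet
  have hm' : ∀ T : ℕ, MeasurableSet {h : History 𝒜.numArms 𝒦.numTerms T |
      ∀ t : Fin T, (h t).1.2 ∈ 𝒜.available t} := fun T => by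
    rw [Set.ofPred_forall]
    exact MeasurableSet.iInter fun t => (measurable_pi_apply t).fst.snd (hm t)
  induction T with
  | zero => exact Filter.Eventually.of_forall fun h t => t.elim0
  | succ T ih =>
    simp only [law]
    rw [ae_map_iff measurable_extend.aemeasurable (hm' _)]
    refine Measure.ae_compProd_of_ae_ae (measurable_extend (hm' _)) ?_
    filter_upwards [ih] with h hh
    have hstep : ∀ᵐ r ∂step π θ T h, r.1.2 ∈ 𝒜.available T := by
      refine Kernel.ae_compProd_of_ae_ae (measurable_fst.snd (hm T)) ?_
      have harm : ∀ᵐ q ∂((π.key T ⊗ₖ Kernel.prodMkLeft _ (keyFeedback 𝒦 θ)) ⊗ₖ π.arm T) h,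
          q.2 ∈ 𝒜.available T :=
        Kernel.ae_compProd_of_ae_ae (measurable_snd (hm T))
          (Filter.Eventually.of_forall fun p => π.arm_mem T (h, p))
      filter_upwards [harm] with q hq
      exact Filter.Eventually.of_forall fun _ => hq
    filter_upwards [hstep] with r hr t
    induction t using Fin.lastCases with
    | last => simpa [extend] using hr
    | cast i => simpa [extend] using hh i

/-! ### Sign vectors -/

/-- The sign `±1` encoded by a Boolean. -/
def boolSign (b : Bool) : ℝ := if b then 1 else -1

theorem boolSign_sq (b : Bool) : boolSign b ^ 2 = 1 := by cases b <;> simp [boolSign]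

theorem boolSign_not (b : Bool) : boolSign (!b) = -boolSign b := by cases b <;> simp [boolSign]

/-- The vector with entries `±Δ` and sign pattern `s`. -/
def signVector {d : ℕ} (Δ : ℝ) (s : Fin d → Bool) : EuclideanSpace ℝ (Fin d) :=
  WithLp.toLp 2 fun i => Δ * boolSign (s i)

/-- Change the `i`-th sign of a sign pattern. -/
def flipSign {d : ℕ} (i : Fin d) (s : Fin d → Bool) : Fin d → Bool := Function.update s i (!s i)

theorem flipSign_involutive {d : ℕ} (i : Fin d) : Function.Involutive (flipSign i) := by
  intro s
  simp [flipSign]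

theorem norm_signVector {d : ℕ} {Δ : ℝ} (hΔ : 0 ≤ Δ) (s : Fin d → Bool) :
    ‖signVector Δ s‖ = Δ * Real.sqrt d := by
  rw [EuclideanSpace.norm_eq]
  simp only [signVector, Real.norm_eq_abs, sq_abs, mul_pow, boolSign_sq, mul_one]
  simp only [Finset.sum_const, Finset.card_univ, Fintype.card_fin, nsmul_eq_mul]
  rw [mul_comm, Real.sqrt_mul (sq_nonneg _), Real.sqrt_sq hΔ]

/-- The flip moves the vector by 2Δ along a single coordinate axis. The factor `x i ^ 2` makes the
sum over `i` collapse to the squared norm of `x`. -/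
theorem inner_signVector_flipSign_sub {d : ℕ} (Δ : ℝ) (i : Fin d) (s : Fin d → Bool)
    (x : EuclideanSpace ℝ (Fin d)) :
    (inner ℝ x (signVector Δ (flipSign i s) - signVector Δ s)) ^ 2 = 4 * Δ ^ 2 * x i ^ 2 := by
  have h : signVector Δ (flipSign i s) - signVector Δ s =
      EuclideanSpace.single i (-2 * Δ * boolSign (s i)) := by
    ext k
    by_cases hk : k = i
    · subst hk
      simp [signVector, flipSign, boolSign_not]; ring
    · simp [signVector, flipSign, hk]
  rw [h, EuclideanSpace.inner_single_right]
  simp only [mul_pow, boolSign_sq, conj_trivial]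
  ring

variable {d : ℕ} {𝒜 : ArmSystem d} {𝒦 : KeyTerms d}

/-- A unit query carries a bounded amount of information about all the signs together. -/
theorem sum_roundGap_flipSign_le (Δ : ℝ) (s : Fin d → Bool)
    (r : Round 𝒜.numArms 𝒦.numTerms) :
    ∑ i, roundGap 𝒜 𝒦 (signVector Δ s) (signVector Δ (flipSign i s)) r ≤ 8 * Δ ^ 2 := by
  have hunit : ∀ x : EuclideanSpace ℝ (Fin d), ‖x‖ = 1 →
      ∑ i, (inner ℝ x (signVector Δ (flipSign i s) - signVector Δ s)) ^ 2 = 4 * Δ ^ 2 := by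
    intro x hx
    simp only [inner_signVector_flipSign_sub]
    rw [← Finset.mul_sum, ← EuclideanSpace.real_norm_sq_eq, hx]
    ring
  simp only [roundGap, Finset.sum_add_distrib, armGap]
  rw [hunit _ (𝒜.norm_feature _)]
  have : ∑ i, keyGap 𝒦 (signVector Δ s) (signVector Δ (flipSign i s)) r.1.1.1 ≤ 4 * Δ ^ 2 := by
    rcases r.1.1.1 with _ | k
    · simp only [keyGap, Finset.sum_const_zero]; positivity
    · exact (hunit _ (𝒦.norm_feature k)).le
  linarith

/-- The information about the `i`-th sign gathered in `T` rounds. -/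
def signInfo (π : Policy 𝒜 𝒦) (T : ℕ) (Δ : ℝ) (s : Fin d → Bool) (i : Fin d) : ℝ :=
  ∫ h, ∑ t, roundGap 𝒜 𝒦 (signVector Δ s) (signVector Δ (flipSign i s)) (h t)
    ∂law π (signVector Δ s) T

theorem signInfo_nonneg (π : Policy 𝒜 𝒦) (T : ℕ) (Δ : ℝ) (s : Fin d → Bool) (i : Fin d) :
    0 ≤ signInfo π T Δ s i :=
  integral_nonneg fun _ => Finset.sum_nonneg fun _ _ => roundGap_nonneg _ _ _

theorem sum_signInfo_le (π : Policy 𝒜 𝒦) (T : ℕ) (Δ : ℝ) (s : Fin d → Bool) :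
    ∑ i, signInfo π T Δ s i ≤ 8 * Δ ^ 2 * T := by
  have hint : ∀ i, Integrable (fun h => ∑ t,
      roundGap 𝒜 𝒦 (signVector Δ s) (signVector Δ (flipSign i s)) (h t))
      (law π (signVector Δ s) T) := fun i =>
    integrable_finsetSum _ fun t _ => integrable_roundGap _ _ π T t
  unfold signInfo
  rw [← integral_finsetSum _ fun i _ => hint i]
  calc _ ≤ ∫ _, 8 * Δ ^ 2 * (T : ℝ) ∂law π (signVector Δ s) T := by
        refine integral_mono (integrable_finsetSum _ fun i _ => hint i) (integrable_const _)
          fun h => ?_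
        simp only
        rw [Finset.sum_comm]
        calc _ ≤ ∑ _ : Fin T, 8 * Δ ^ 2 :=
              Finset.sum_le_sum fun t _ => sum_roundGap_flipSign_le Δ s (h t)
          _ = 8 * Δ ^ 2 * (T : ℝ) := by simp [mul_comm]
    _ = _ := by simp

/-! ### Arms given by sign patterns on blocks of coordinates -/

section Block

variable {n g : ℕ}

/-- The block and the sign pattern of an arm. -/
def blockEquiv (n g : ℕ) :
    Fin (Fintype.card (Fin n × (Fin g → Bool))) ≃ Fin n × (Fin g → Bool) :=
  (Fintype.equivFin _).symm

/-- `c` places the blocks disjointly among the coordinates. -/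
def blockFeature (c : Fin n × Fin g ↪ Fin d) (p : Fin n × (Fin g → Bool)) :
    EuclideanSpace ℝ (Fin d) :=
  ∑ j, (boolSign (p.2 j) / Real.sqrt g) • EuclideanSpace.single (c (p.1, j)) (1 : ℝ)

theorem inner_blockFeature (c : Fin n × Fin g ↪ Fin d) (p : Fin n × (Fin g → Bool))
    (v : EuclideanSpace ℝ (Fin d)) :
    inner ℝ (blockFeature c p) v = ∑ j, boolSign (p.2 j) / Real.sqrt g * v (c (p.1, j)) := by
  simp [blockFeature, sum_inner, inner_smul_left, EuclideanSpace.inner_single_left]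

theorem norm_blockFeature (hg : 0 < g) (c : Fin n × Fin g ↪ Fin d)
    (p : Fin n × (Fin g → Bool)) : ‖blockFeature c p‖ = 1 := by
  have ho : Orthonormal ℝ fun j => EuclideanSpace.single (c (p.1, j)) (1 : ℝ) :=
    (EuclideanSpace.orthonormal_single (𝕜 := ℝ) (ι := Fin d)).comp _ fun j k h =>
      (Prod.mk.inj (c.injective h)).2
  have hg' : (g : ℝ) ≠ 0 := by positivity
  rw [← sq_eq_sq₀ (norm_nonneg _) zero_le_one, ← real_inner_self_eq_norm_sq, blockFeature,
    ho.inner_sum]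
  simp only [conj_trivial, ← sq, div_pow, boolSign_sq, Real.sq_sqrt (Nat.cast_nonneg g)]
  simp [hg']

variable [NeZero n]

/-- In round `t` the arms are the sign patterns on the block `t mod n`. -/
def blockArms (hg : 0 < g) (c : Fin n × Fin g ↪ Fin d) : ArmSystem d where
  numArms := Fintype.card (Fin n × (Fin g → Bool))
  feature a := blockFeature c (blockEquiv n g a)
  norm_feature a := norm_blockFeature hg c _
  available t := Finset.univ.filter fun a => (blockEquiv n g a).1 = Fin.ofNat n t
  available_nonempty t := ⟨(blockEquiv n g).symm (Fin.ofNat n t, fun _ => true), by simp⟩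

variable (hg : 0 < g) (c : Fin n × Fin g ↪ Fin d)

theorem mem_available_blockArms (t : ℕ) (a : Fin (blockArms hg c).numArms) :
    a ∈ (blockArms hg c).available t ↔ (blockEquiv n g a).1 = Fin.ofNat n t := by
  exact Finset.mem_filter_univ (p := fun a => (blockEquiv n g a).1 = Fin.ofNat n t) a

theorem card_available_blockArms (t : ℕ) : ((blockArms hg c).available t).card ≤ 2 ^ g := by
  have : ((blockArms hg c).available t).card ≤ (Finset.univ : Finset (Fin g → Bool)).card := by
    refine Finset.card_le_card_of_injOn (fun a => (blockEquiv n g a).2)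
      (fun _ _ => Finset.mem_coe.2 (Finset.mem_univ _)) fun a ha b hb h => ?_
    have ha' := (mem_available_blockArms hg c t a).1 (Finset.mem_coe.1 ha)
    have hb' := (mem_available_blockArms hg c t b).1 (Finset.mem_coe.1 hb)
    exact (blockEquiv n g).injective (Prod.ext (ha'.trans hb'.symm) h)
  simpa using this

/-- In round `t` an arm is chosen whose `j`-th sign is wrong. -/
def wrongSign (M : ℕ) {T : ℕ} (s : Fin d → Bool) (t : Fin T) (j : Fin g) :
    Set (History (blockArms hg c).numArms M T) :=
  {h | (blockEquiv n g (h t).1.2).2 j ≠ s (c (Fin.ofNat n t, j))}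

theorem measurableSet_wrongSign {M T : ℕ} (s : Fin d → Bool) (t : Fin T) (j : Fin g) :
    MeasurableSet (wrongSign hg c M s t j) := by
  have h : MeasurableSet {a : Fin (blockArms hg c).numArms |
      (blockEquiv n g a).2 j ≠ s (c (Fin.ofNat n t, j))} := (Set.to_countable _).measurableSet
  exact (measurable_pi_apply t).fst.snd h

theorem wrongSign_flipSign {M T : ℕ} (s : Fin d → Bool) (t : Fin T) (j : Fin g) :
    wrongSign hg c M (flipSign (c (Fin.ofNat n t, j)) s) t j = (wrongSign hg c M s t j)ᶜ := by
  ext h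
  simp only [wrongSign, flipSign, Set.mem_compl_iff, Set.mem_ofPred_eq, Function.update_self]
  cases (blockEquiv n g (h t).1.2).2 j <;> cases s (c (Fin.ofNat n t, j)) <;> simp

theorem le_regret_blockArms {M T : ℕ} (Δ : ℝ) (s : Fin d → Bool)
    (h : History (blockArms hg c).numArms M T)
    (hh : ∀ t : Fin T, (h t).1.2 ∈ (blockArms hg c).available t) :
    ∑ t, ∑ j, 2 * Δ / Real.sqrt g * (wrongSign hg c M s t j).indicator (fun _ => (1 : ℝ)) h ≤
      regret (blockArms hg c) (signVector Δ s) h := by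
  unfold regret
  refine Finset.sum_le_sum fun t _ => ?_
  -- The competitor reproduces the true signs on the current block.
  let b : Fin (blockArms hg c).numArms :=
    (blockEquiv n g).symm (Fin.ofNat n t, fun j => s (c (Fin.ofNat n t, j)))
  have hb : blockEquiv n g b = (Fin.ofNat n t, fun j => s (c (Fin.ofNat n t, j))) :=
    (blockEquiv n g).apply_symm_apply _
  have hmem : b ∈ (blockArms hg c).available t := by
    rw [mem_available_blockArms, hb]
  refine le_trans ?_ (sub_le_sub_right (Finset.le_sup'
    (fun a => inner ℝ ((blockArms hg c).feature a) (signVector Δ s)) hmem) _)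
  have ha := (mem_available_blockArms hg c _ _).1 (hh t)
  change _ ≤ inner ℝ (blockFeature c (blockEquiv n g b)) _ -
    inner ℝ (blockFeature c (blockEquiv n g (h t).1.2)) _
  rw [inner_blockFeature, inner_blockFeature, hb, ha, ← Finset.sum_sub_distrib]
  refine Finset.sum_le_sum fun j _ => ?_
  simp only [signVector, wrongSign, Set.indicator_apply, Set.mem_ofPred_eq]
  split_ifs with hne
  · have hsq := boolSign_sq (s (c (Fin.ofNat n t, j)))
    rw [Bool.eq_not_of_ne hne, boolSign_not]
    refine le_of_eq ?_
    linear_combination (-(2 * Δ / Real.sqrt g)) * hsq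
  · rw [not_not.1 hne, sub_self, mul_zero]

theorem le_expectedRegret_blockArms (π : Policy (blockArms hg c) 𝒦) (T : ℕ) (Δ : ℝ)
    (s : Fin d → Bool) :
    ∑ t : Fin T, ∑ j, 2 * Δ / Real.sqrt g *
        (law π (signVector Δ s) T).real (wrongSign hg c 𝒦.numTerms s t j) ≤
      expectedRegret π (signVector Δ s) T := by
  have hint : ∀ (t : Fin T) j, Integrable (fun h => 2 * Δ / Real.sqrt g *
      (wrongSign hg c 𝒦.numTerms s t j).indicator (fun _ => (1 : ℝ)) h) (law π (signVector Δ s) T) :=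
    fun t j => ((integrable_const (1 : ℝ)).indicator
      (measurableSet_wrongSign hg c s t j)).const_mul _
  calc _ = ∫ h, ∑ t, ∑ j, 2 * Δ / Real.sqrt g *
        (wrongSign hg c 𝒦.numTerms s t j).indicator (fun _ => (1 : ℝ)) h ∂law π (signVector Δ s) T := by
        rw [integral_finsetSum _ fun t _ => integrable_finsetSum _ fun j _ => hint t j]
        refine Finset.sum_congr rfl fun t _ => ?_
        rw [integral_finsetSum _ fun j _ => hint t j]
        refine Finset.sum_congr rfl fun j _ => ?_
        rw [integral_const_mul, integral_indicator (measurableSet_wrongSign hg c s t j)]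
        simp
    _ ≤ _ := by
        refine integral_mono_ae (integrable_finsetSum _ fun t _ =>
          integrable_finsetSum _ fun j _ => hint t j) (integrable_regret π _ T) ?_
        filter_upwards [ae_arm_mem_available (signVector Δ s) π T] with h hh
        exact le_regret_blockArms hg c Δ s h hh

/-- Being wrong for `s` is being right for its flip, so the event is a test between the two.
Flipping permutes the sign patterns, so both error terms have the same sum over `s`; hence the
factor 2. -/
theorem sum_log_two_sub_le_sum_wrongSign (π : Policy (blockArms hg c) 𝒦) {T : ℕ} (Δ : ℝ)
    (t : Fin T) (j : Fin g) :
    ∑ s, (Real.log 2 - signInfo π T Δ s (c (Fin.ofNat n t, j)) / 2) ≤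
      2 * ∑ s, (law π (signVector Δ s) T).real (wrongSign hg c 𝒦.numTerms s t j) := by
  set i := c (Fin.ofNat n t, j)
  have hflip : ∑ s, (law π (signVector Δ (flipSign i s)) T).real
      (wrongSign hg c 𝒦.numTerms (flipSign i s) t j) =
      ∑ s, (law π (signVector Δ s) T).real (wrongSign hg c 𝒦.numTerms s t j) :=
    Equiv.sum_comp (flipSign_involutive i).toPerm fun s =>
      (law π (signVector Δ s) T).real (wrongSign hg c 𝒦.numTerms s t j)
  rw [two_mul]
  nth_rewrite 2 [← hflip]
  rw [← Finset.sum_add_distrib]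
  refine Finset.sum_le_sum fun s _ => ?_
  rw [wrongSign_flipSign]
  exact log_two_sub_le_test _ _ π T (measurableSet_wrongSign hg c s t j)

/-! ### Equidistribution of the rounds over the blocks -/

theorem card_ofNat_eq_mul_le {T : ℕ} (hn : n ≤ T) (γ : Fin n) :
    (Finset.univ.filter fun t : Fin T => Fin.ofNat n t = γ).card * n ≤ 2 * T := by
  have hn0 : 0 < n := Nat.pos_of_neZero n
  have h : (Finset.univ.filter fun t : Fin T => Fin.ofNat n t = γ).card ≤
      Nat.count (· ≡ γ [MOD n]) T := by
    rw [Nat.count_eq_card_filter_range]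
    refine Finset.card_le_card_of_injOn Fin.val (fun t ht => ?_) Fin.val_injective.injOn
    have ht' := (Finset.mem_filter.1 (Finset.mem_coe.1 ht)).2
    refine Finset.mem_coe.2 (Finset.mem_filter.2 ⟨Finset.mem_range.2 t.2, ?_⟩)
    rw [← ht', Nat.ModEq]
    simp
  refine (Nat.mul_le_mul_right n h).trans ?_
  rw [Nat.count_modEq_card _ hn0]
  -- A residue class has at most T/n + 1 elements below T, and the extra 1 costs n ≤ T after
  -- multiplication by n.
  have h1 : T / n * n ≤ T := Nat.div_mul_le_self _ _
  split_ifs <;> nlinarith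

theorem sum_ofNat_mul_le {T : ℕ} (hn : n ≤ T) {f : Fin n → ℝ} (hf : ∀ γ, 0 ≤ f γ) :
    (∑ t : Fin T, f (Fin.ofNat n t)) * n ≤ 2 * T * ∑ γ, f γ := by
  rw [← Finset.sum_fiberwise_of_maps_to (s := Finset.univ) (t := Finset.univ)
    (g := fun t : Fin T => Fin.ofNat n t) (fun _ _ => Finset.mem_univ _), Finset.sum_mul,
    Finset.mul_sum]
  refine Finset.sum_le_sum fun γ _ => ?_
  rw [Finset.sum_congr rfl fun t ht => by rw [(Finset.mem_filter.1 ht).2], Finset.sum_const,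
    nsmul_eq_mul]
  have h : ((Finset.univ.filter fun t : Fin T => Fin.ofNat n t = γ).card * n : ℝ) ≤ 2 * T := by
    exact_mod_cast card_ofNat_eq_mul_le hn γ
  nlinarith [mul_le_mul_of_nonneg_right h (hf γ)]

theorem sum_signInfo_block_le (π : Policy (blockArms hg c) 𝒦) {T : ℕ} (hn : n ≤ T) (Δ : ℝ)
    (s : Fin d → Bool) :
    (∑ t : Fin T, ∑ j, signInfo π T Δ s (c (Fin.ofNat n t, j))) * n ≤
      2 * T * (8 * Δ ^ 2 * T) := by
  refine (sum_ofNat_mul_le hn (f := fun γ => ∑ j, signInfo π T Δ s (c (γ, j)))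
    fun γ => Finset.sum_nonneg fun j _ => signInfo_nonneg _ _ _ _ _).trans ?_
  refine mul_le_mul_of_nonneg_left (le_trans ?_ (sum_signInfo_le π T Δ s)) (by positivity)
  rw [← Fintype.sum_prod_type', ← Finset.sum_map Finset.univ c]
  exact Finset.sum_le_sum_of_subset_of_nonneg (Finset.subset_univ _)
    fun i _ _ => signInfo_nonneg _ _ _ _ _

/-- Against every policy, some sign vector leads to large regret on the block arms. -/
theorem exists_le_expectedRegret_blockArms (π : Policy (blockArms hg c) 𝒦) {T : ℕ} (hT : 1 ≤ T)
    (hn : n ≤ T) (hd : d ≤ 2 * (n * g)) {Δ : ℝ} (hΔ : 0 ≤ Δ) (hΔd : 64 * (Δ ^ 2 * T) = d) :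
    ∃ s, Δ * Real.sqrt g * T * (2 / 5) ≤ expectedRegret π (signVector Δ s) T := by
  have hn0 : (0 : ℝ) < n := by exact_mod_cast Nat.pos_of_neZero n
  have hg0 : (0 : ℝ) < g := by exact_mod_cast hg
  have hsg : 0 < Real.sqrt g := Real.sqrt_pos.2 hg0
  have hlog := Real.log_two_gt_d9
  -- Since 8Δ²T = d/8, the sum is at most (2T/n)(d/8), and d ≤ 2ng.
  have hinfo : ∀ s, ∑ t : Fin T, ∑ j, signInfo π T Δ s (c (Fin.ofNat n t, j)) ≤ T * g / 2 := by
    intro s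
    have h := sum_signInfo_block_le hg c π hn Δ s
    have hd' : (d : ℝ) ≤ 2 * (n * g) := by exact_mod_cast hd
    have hT0 : (0 : ℝ) ≤ T := Nat.cast_nonneg T
    refine le_of_mul_le_mul_right (h.trans ?_) hn0
    nlinarith [mul_le_mul_of_nonneg_left hd' hT0]
  obtain ⟨s, -, hs⟩ := Finset.exists_le_of_sum_le (s := (Finset.univ : Finset (Fin d → Bool)))
    (f := fun _ => Δ * Real.sqrt g * T * (2 / 5))
    (g := fun s => expectedRegret π (signVector Δ s) T) Finset.univ_nonempty (by
      have hfac : 0 ≤ Δ / Real.sqrt g := by positivity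
      calc ∑ _ : Fin d → Bool, Δ * Real.sqrt g * T * (2 / 5)
          ≤ ∑ s, Δ / Real.sqrt g * ∑ t : Fin T, ∑ j,
              (Real.log 2 - signInfo π T Δ s (c (Fin.ofNat n t, j)) / 2) := by
            refine Finset.sum_le_sum fun s _ => ?_
            have h1 : Δ * Real.sqrt g * T * (2 / 5) =
                Δ / Real.sqrt g * (T * g * (2 / 5)) := by
              field_simp
              rw [Real.sq_sqrt hg0.le]
            rw [h1]
            refine mul_le_mul_of_nonneg_left ?_ hfac
            -- The average over the Tg pairs (t, j) is at least log 2 - 1/4 > 2/5.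
            simp only [Finset.sum_sub_distrib, ← Finset.sum_div]
            simp only [Finset.sum_const, Finset.card_univ, Fintype.card_fin, nsmul_eq_mul]
            have := hinfo s
            have hTg : (0 : ℝ) ≤ T * g := by positivity
            nlinarith
        _ = Δ / Real.sqrt g * ∑ t : Fin T, ∑ j, ∑ s,
              (Real.log 2 - signInfo π T Δ s (c (Fin.ofNat n t, j)) / 2) := by
            rw [← Finset.mul_sum, Finset.sum_comm (s := Finset.univ (α := Fin d → Bool))]
            refine congrArg _ (Finset.sum_congr rfl fun t _ => ?_)
            rw [Finset.sum_comm]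
        _ ≤ Δ / Real.sqrt g * ∑ t : Fin T, ∑ j, 2 * ∑ s,
              (law π (signVector Δ s) T).real (wrongSign hg c 𝒦.numTerms s t j) :=
            mul_le_mul_of_nonneg_left (Finset.sum_le_sum fun t _ => Finset.sum_le_sum fun j _ =>
              sum_log_two_sub_le_sum_wrongSign hg c π Δ t j) hfac
        _ = ∑ s, ∑ t : Fin T, ∑ j, 2 * Δ / Real.sqrt g *
              (law π (signVector Δ s) T).real (wrongSign hg c 𝒦.numTerms s t j) := by
            rw [Finset.sum_comm (s := Finset.univ (α := Fin d → Bool)), Finset.mul_sum]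
            refine Finset.sum_congr rfl fun t _ => ?_
            rw [Finset.sum_comm (s := Finset.univ (α := Fin d → Bool)), Finset.mul_sum]
            refine Finset.sum_congr rfl fun j _ => ?_
            rw [Finset.mul_sum, Finset.mul_sum]
            refine Finset.sum_congr rfl fun s _ => ?_
            ring
        _ ≤ _ := Finset.sum_le_sum fun s _ => le_expectedRegret_blockArms hg c π T Δ s)
  exact ⟨s, hs⟩

end Block

/-! ### Choice of the blocks, of Δ and of the block size -/

theorem exists_armSystem_le_expectedRegret {d g T : ℕ} (hg : 0 < g) (hgd : g ≤ d) (hT : 1 ≤ T)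
    (hn : d / g ≤ T) :
    ∃ 𝒜 : ArmSystem d, (∀ t, (𝒜.available t).card ≤ 2 ^ g) ∧
      ∀ (𝒦 : KeyTerms d) (π : Policy 𝒜 𝒦), ∃ θ : EuclideanSpace ℝ (Fin d),
        ‖θ‖ ≤ (d : ℝ) / Real.sqrt T ∧
        1 / 20 * Real.sqrt ((d : ℝ) * T * g) ≤ expectedRegret π θ T := by
  have : NeZero (d / g) := ⟨(Nat.div_pos hgd hg).ne'⟩
  have hle : d / g * g ≤ d := Nat.div_mul_le_self d g
  -- Fewer than g coordinates are left over, and there is at least one full block.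
  have hd2 : d ≤ 2 * (d / g * g) := by
    have h1 := Nat.div_add_mod d g
    have h2 := Nat.mod_lt d hg
    have h3 : g ≤ d / g * g := Nat.le_mul_of_pos_left g (Nat.div_pos hgd hg)
    rw [mul_comm] at h1
    omega
  let c : Fin (d / g) × Fin g ↪ Fin d :=
    finProdFinEquiv.toEmbedding.trans (Fin.castLEEmb hle)
  have hT0 : (0 : ℝ) < T := by exact_mod_cast hT
  -- The largest scale, up to constants, at which the total information 8Δ²T stays a small fraction
  -- of d.
  set Δ : ℝ := Real.sqrt d / (8 * Real.sqrt T)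
  have hΔ : 0 ≤ Δ := by positivity
  have hsT : Real.sqrt T ^ 2 = T := Real.sq_sqrt hT0.le
  have hsd : Real.sqrt d ^ 2 = d := Real.sq_sqrt (Nat.cast_nonneg d)
  have hsT0 : 0 < Real.sqrt T := Real.sqrt_pos.2 hT0
  refine ⟨blockArms hg c, card_available_blockArms hg c, fun 𝒦 π => ?_⟩
  obtain ⟨s, hs⟩ := exists_le_expectedRegret_blockArms hg c π hT hn hd2 hΔ (by
    simp only [Δ, div_pow, mul_pow, hsT, hsd]
    field_simp
    ring)
  refine ⟨signVector Δ s, ?_, le_trans (le_of_eq ?_) hs⟩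
  · rw [norm_signVector hΔ]
    have : Δ * Real.sqrt d = d / Real.sqrt T / 8 := by
      simp only [Δ]
      rw [div_mul_eq_mul_div, ← sq, hsd]
      field_simp
    rw [this]
    exact div_le_self (by positivity) (by norm_num)
  · rw [Real.sqrt_mul (by positivity), Real.sqrt_mul (by positivity)]
    simp only [Δ]
    nth_rewrite 3 [← hsT]
    field_simp
    ring

end ConversationalBandit

end

theorem mainTheorem4 :
    ∃ c : ℝ, 0 < c ∧
      (∀ d T : ℕ, 1 ≤ d → 1 ≤ T →
        ∃ 𝒜 : ConversationalBandit.ArmSystem d,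
          (d ≤ T → ∀ t, (𝒜.available t).card ≤ 2) ∧
          ∀ (𝒦 : ConversationalBandit.KeyTerms d) (π : ConversationalBandit.Policy 𝒜 𝒦),
            ∃ θ : EuclideanSpace ℝ (Fin d),
              ‖θ‖ ≤ (d : ℝ) / Real.sqrt (T : ℝ) ∧
              c * Real.sqrt ((d : ℝ) * (T : ℝ)) ≤
                ConversationalBandit.expectedRegret π θ T) ∧
      (∀ d m T : ℕ, 1 ≤ m → m ≤ d → T = 2 ^ m →
        ∃ 𝒜 : ConversationalBandit.ArmSystem d,
          (d ≤ T → ∀ t, (𝒜.available t).card ≤ T) ∧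
          ∀ (𝒦 : ConversationalBandit.KeyTerms d) (π : ConversationalBandit.Policy 𝒜 𝒦),
            ∃ θ : EuclideanSpace ℝ (Fin d),
              ‖θ‖ ≤ (d : ℝ) / Real.sqrt (T : ℝ) ∧
              c * Real.sqrt ((d : ℝ) * (T : ℝ) * Real.log (T : ℝ)) ≤
                ConversationalBandit.expectedRegret π θ T) := by
  -- 1/20 is the 1/8 in Δ times the 2/5 from the test errors.
  refine ⟨1 / 20, by norm_num, fun d T hd hT => ?_, fun d m T hm hmd hTm => ?_⟩
  · obtain ⟨g, hg, hgd, hn, hcard⟩ :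
        ∃ g, 0 < g ∧ g ≤ d ∧ d / g ≤ T ∧ (d ≤ T → 2 ^ g ≤ 2) := by
      rcases le_or_gt d T with h | h
      · exact ⟨1, one_pos, hd, by simpa using h, fun _ => le_rfl⟩
      -- With fewer rounds than coordinates, blocks of size 1 could not all be visited. A single
      -- block is used, with no limit on the number of arms.
      · exact ⟨d, hd, le_rfl, by rwa [Nat.div_self hd], fun h' => absurd h' h.not_ge⟩
    obtain ⟨𝒜, h𝒜, H⟩ :=
      ConversationalBandit.exists_armSystem_le_expectedRegret hg hgd hT hn
    refine ⟨𝒜, fun h t => (h𝒜 t).trans (hcard h), fun 𝒦 π => ?_⟩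
    obtain ⟨θ, hθ, hR⟩ := H 𝒦 π
    refine ⟨θ, hθ, le_trans ?_ hR⟩
    have hg1 : (1 : ℝ) ≤ g := by exact_mod_cast hg
    exact mul_le_mul_of_nonneg_left
      (Real.sqrt_le_sqrt (le_mul_of_one_le_right (by positivity) hg1)) (by norm_num)
  · have hT : 1 ≤ T := hTm ▸ Nat.one_le_two_pow
    obtain ⟨g, hmg, hgd, hn, hcard⟩ :
        ∃ g, m ≤ g ∧ g ≤ d ∧ d / g ≤ T ∧ (d ≤ T → 2 ^ g ≤ T) := by
      rcases le_or_gt d T with h | h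
      · exact ⟨m, le_rfl, hmd, (Nat.div_le_self d m).trans h, fun _ => hTm.ge⟩
      · exact ⟨d, hmd, le_rfl, by rwa [Nat.div_self (hm.trans hmd)],
          fun h' => absurd h' h.not_ge⟩
    obtain ⟨𝒜, h𝒜, H⟩ :=
      ConversationalBandit.exists_armSystem_le_expectedRegret (hm.trans hmg) hgd hT hn
    refine ⟨𝒜, fun h t => (h𝒜 t).trans (hcard h), fun 𝒦 π => ?_⟩
    obtain ⟨θ, hθ, hR⟩ := H 𝒦 π
    refine ⟨θ, hθ, le_trans ?_ hR⟩
    -- log T = m log 2 ≤ m ≤ g.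
    have hlog : Real.log T ≤ g := by
      have h2 : Real.log 2 ≤ 1 := by linarith [Real.log_two_lt_d9]
      have hmg' : (m : ℝ) ≤ g := by exact_mod_cast hmg
      rw [hTm, Nat.cast_pow, Real.log_pow]
      push_cast
      nlinarith [Nat.cast_nonneg (α := ℝ) m]
    gcongr
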